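/- **Definitions.** A subspace $\mathscr C\subseteq(\mathbb C^2)^{\otimes n}$ with orthogonal projector $P$ is an $[[n,k,d]]$ quantum error-correcting code (QECC) if $\dim\mathscr C=2^k$ with $1\le k\le n$, for every $n$-qubit Pauli operator $O$ of weight at most $d-1$ there is $\alpha\in\mathbb C$ with $POP=\alpha P$, and this fails for some Pauli operator of weight $d$ (so $d$ is the code distance). A family of pure states $\{|\psi_n\rangle\in(\mathbb C^2)^{\otimes n}\}_{n\in\mathbb N_s}$, with $\mathbb N_s\subseteq\mathbb N$ infinite, is in the class *TQO-1* if there are $c\in(0,1]$, functions $n\mapsto k_n,d_n$ with $d_n=\Theta(n^c)$ as $n\to\infty$ in $\mathbb N_s$, and $[[n,k_n,d_n]]$ QECCs $\mathscr C_n$ such that $|\psi_n\rangle\in\mathscr C_n$ for all $n\in\mathbb N_s$. The graph state of a graph $G=(V,E)$ on $n$ vertices is $|G\rangle=\prod_{(u,v)\in E}\mathrm{CZ}(u,v)\,H^{\otimes n}|0^n\rangle$. For an integer $L\ge1$ the generalized (3D) toric graph $G_{\rm gtoric}$ has vertex set $\{1,\dots,L\}^3$ and adjacency matrix over $\mathbb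 Z_2$ $$\begin{aligned}A_{i_1j_1k_1,\,i_2j_2k_2}={}&\delta_{j_1,j_2}\delta_{k_1,k_2}\bigl(\delta_{i_1,1}\theta_{2,i_2}+\delta_{i_2,1}\theta_{2,i_1}\bigr)\\&+\delta_{j_1,j_2}\bigl(\delta_{k_1,k_2+1}\theta_{i_2,i_1}\theta_{2,i_2}+\delta_{k_2,k_1+1}\theta_{i_1,i_2}\theta_{2,i_1}\bigr)\\&+\delta_{j_1,j_2+1}\delta_{k_1,k_2+1}\theta_{i_2,i_1}\theta_{2,i_2}+\delta_{j_2,j_1+1}\delta_{k_2,k_1+1}\theta_{i_1,i_2}\theta_{2,i_1},\end{aligned}$$ where $\theta_{a,b}=1$ if $a\le b$ and $0$ otherwise, $\delta$ is the Kronecker delta, and the coordinates $j$ and $k$ are taken modulo $L$ (periodic boundary conditions). **Theorem.** The family of generalized toric graph states $\{|G_{\rm gtoric}\rangle\in(\mathbb C^2)^{\otimes L^3}\}_{L\ge1}$ is in the class TQO-1. -/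

import Mathlib

open scoped Matrix

noncomputable section

/-! ### Qubits, gates and Pauli operators -/

/-- The Hilbert space of a system of qubits labelled by `V`; its orthonormal basis
`|x⟩` is labelled by the bitstrings `x : V → Fin 2`. -/
abbrev QubitSpace (V : Type) [Fintype V] [DecidableEq V] : Type :=
  EuclideanSpace ℂ (V → Fin 2)

/-- Operators on `QubitSpace V`, as matrices in the computational basis. -/
abbrev QubitOp (V : Type) : Type := Matrix (V → Fin 2) (V → Fin 2) ℂ

/-- The action of an operator on a vector. -/
def QubitOp.app {V : Type} [Fintype V] [DecidableEq V] (M : QubitOp V) (ψ : QubitSpace V) :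
    QubitSpace V :=
  WithLp.toLp 2 (M *ᵥ ψ.ofLp)

/-- The tensor product `⨂ v, U v` of one-qubit operators. -/
def tensorOp {V : Type} [Fintype V] (U : V → Matrix (Fin 2) (Fin 2) ℂ) : QubitOp V :=
  Matrix.of fun x y => ∏ v, U v (x v) (y v)

/-- The one-qubit Pauli operator `X`. -/
def pauliX : Matrix (Fin 2) (Fin 2) ℂ := !![0, 1; 1, 0]

/-- The one-qubit Pauli operator `Z`. -/
def pauliZ : Matrix (Fin 2) (Fin 2) ℂ := !![1, 0; 0, -1]

/-- The one-qubit Hadamard gate. -/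
def hadamard : Matrix (Fin 2) (Fin 2) ℂ :=
  ((Real.sqrt 2 : ℝ) : ℂ)⁻¹ • !![1, 1; 1, -1]

/-- The Pauli operator `X^k Z^l = ⨂ v, X^(k v) Z^(l v)`. Up to the prefactors `±1, ±i`
these are all elements of the Pauli group (with `Y` being `X Z` up to a prefactor). -/
def pauliOp {V : Type} [Fintype V] (k l : V → Fin 2) : QubitOp V :=
  tensorOp fun v => pauliX ^ (k v : ℕ) * pauliZ ^ (l v : ℕ)

/-- The weight of `X^k Z^l`: the number of qubits on which it acts non-trivially. -/
def pauliWeight {V : Type} [Fintype V] (k l : V → Fin 2) : ℕ :=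
  (Finset.univ.filter fun v => k v ≠ 0 ∨ l v ≠ 0).card

/-! ### Quantum error-correcting codes -/

/-- The quantum error correction condition `P O P = α P`, where `P` is the orthogonal projector
onto the subspace `C`, written out in matrix elements between vectors of `C`. -/
def IsDetectable {V : Type} [Fintype V] [DecidableEq V]
    (C : Submodule ℂ (QubitSpace V)) (O : QubitOp V) : Prop :=
  ∃ α : ℂ, ∀ φ ∈ C, ∀ ψ ∈ C, inner ℂ φ (O.app ψ) = α * inner ℂ φ ψ

/-- `C` has code distance `d`: every Pauli operator of weight at most `d - 1` satisfies the error
correction condition on `C`, and some Pauli operator of weight `d` does not. -/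
def HasCodeDistance {V : Type} [Fintype V] [DecidableEq V]
    (C : Submodule ℂ (QubitSpace V)) (d : ℕ) : Prop :=
  (∀ k l : V → Fin 2, pauliWeight k l < d → IsDetectable C (pauliOp k l)) ∧
    ∃ k l : V → Fin 2, pauliWeight k l = d ∧ ¬ IsDetectable C (pauliOp k l)

/-- `C` is an `[[n, k, d]]` QECC, where `n` is the number of qubits in `V`. -/
def IsQECC {V : Type} [Fintype V] [DecidableEq V]
    (C : Submodule ℂ (QubitSpace V)) (k d : ℕ) : Prop :=
  1 ≤ k ∧ k ≤ Fintype.card V ∧ Module.finrank ℂ C = 2 ^ k ∧ HasCodeDistance C d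

/-! ### Families of states and the class TQO-1 -/

/-- A family of quantum states `|ψ_n⟩`, `n ∈ N_s`, on `n` qubits, with `N_s ⊆ ℕ` infinite.
The index type `ι` is identified with `N_s` by the injective map that sends an index to the number
of qubits, and the `n` qubits may be labelled by any `n`-element type. -/
structure StateFamily where
  /-- The index set. -/
  ι : Type
  /-- The labels of the qubits. -/
  Qubit : ι → Type
  fintypeQubit : ∀ i, Fintype (Qubit i)
  decEqQubit : ∀ i, DecidableEq (Qubit i)
  infinite_index : Infinite ι
  card_injective : Function.Injective fun i => Fintype.card (Qubit i)
  /-- The states. -/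
  state : ∀ i, QubitSpace (Qubit i)
  norm_state : ∀ i, ‖state i‖ = 1

attribute [instance] StateFamily.fintypeQubit StateFamily.decEqQubit

/-- The number `n` of qubits. -/
def StateFamily.size (S : StateFamily) (i : S.ι) : ℕ := Fintype.card (S.Qubit i)

/-- The class TQO-1: the families of states `|ψ_n⟩` for which there are `[[n, k_n, d_n]]` QECCs
containing `|ψ_n⟩`, for all `n` in the index set, of macroscopic distance: `d_n = Θ(n ^ c)` as
`n → ∞` for some `0 < c ≤ 1`. -/
def TQO1 : Set StateFamily :=
  {S | ∃ (C : ∀ i, Submodule ℂ (QubitSpace (S.Qubit i))) (k d : S.ι → ℕ),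
    (∀ i, IsQECC (C i) (k i) (d i)) ∧
    (∃ c : ℝ, 0 < c ∧ c ≤ 1 ∧
      (fun i => (d i : ℝ)) =Θ[Filter.comap S.size Filter.atTop] fun i => (S.size i : ℝ) ^ c) ∧
    ∀ i, S.state i ∈ C i}

/-! ### Graph states -/

/-- The controlled-`Z` gate on the two end points of `e`. -/
def czGate {V : Type} [Fintype V] [DecidableEq V] (e : Sym2 V) : QubitOp V :=
  Matrix.diagonal fun x => if ∀ v ∈ e, x v = 1 then -1 else 1

theorem czGate_commute {V : Type} [Fintype V] [DecidableEq V] (e f : Sym2 V) :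
    Commute (czGate e) (czGate f) := by
  unfold czGate
  exact Matrix.commute_diagonal _ _

/-- The product of the controlled-`Z` gates over all edges of a graph. -/
def czCircuit {V : Type} [Fintype V] [DecidableEq V] (G : SimpleGraph V) [DecidableRel G.Adj] :
    QubitOp V :=
  G.edgeFinset.noncommProd czGate fun e _ f _ _ => czGate_commute e f

/-- The computational basis state `|0^n⟩`. -/
def zeroKet (V : Type) [Fintype V] [DecidableEq V] : QubitSpace V :=
  EuclideanSpace.single (0 : V → Fin 2) (1 : ℂ)

/-- The graph state `|G⟩ = ∏_{(i,j) ∈ E} CZ(i,j) H^{⊗n} |0^n⟩`. -/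
def graphState {V : Type} [Fintype V] [DecidableEq V] (G : SimpleGraph V) [DecidableRel G.Adj] :
    QubitSpace V :=
  (czCircuit G).app ((tensorOp fun _ : V => hadamard).app (zeroKet V))

theorem czCircuit_eq {V : Type} [Fintype V] [DecidableEq V] (G : SimpleGraph V)
    [DecidableRel G.Adj] :
    czCircuit G = Matrix.diagonal fun x : V → Fin 2 =>
      ∏ e ∈ G.edgeFinset, if ∀ v ∈ e, x v = 1 then (-1 : ℂ) else 1 := by
  have key : ∀ (s : Finset (Sym2 V)) (h : (s : Set (Sym2 V)).Pairwise (Function.onFun Commute czGate)),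
      s.noncommProd czGate h = Matrix.diagonal fun x : V → Fin 2 =>
        ∏ e ∈ s, if ∀ v ∈ e, x v = 1 then (-1 : ℂ) else 1 := by
    intro s
    induction s using Finset.induction_on with
    | empty => intro h; simp
    | insert a s ha ih =>
      intro h
      rw [Finset.noncommProd_insert_of_notMem _ _ _ _ ha, ih, czGate, Matrix.diagonal_mul_diagonal]
      simp only [Finset.prod_insert ha]
  exact key _ _

theorem graphState_apply {V : Type} [Fintype V] [DecidableEq V] (G : SimpleGraph V)
    [DecidableRel G.Adj] (x : V → Fin 2) :
    (graphState G).ofLp x = (∏ e ∈ G.edgeFinset, if ∀ v ∈ e, x v = 1 then (-1 : ℂ) else 1) *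
      (((Real.sqrt 2 : ℝ) : ℂ)⁻¹) ^ Fintype.card V := by
  have h0 : ∀ a : Fin 2, hadamard a 0 = ((Real.sqrt 2 : ℝ) : ℂ)⁻¹ := by
    intro a; fin_cases a <;> simp [hadamard]
  simp [graphState, QubitOp.app, czCircuit_eq, zeroKet, Matrix.mulVec_diagonal, tensorOp, h0]

theorem norm_graphState {V : Type} [Fintype V] [DecidableEq V] (G : SimpleGraph V)
    [DecidableRel G.Adj] : ‖graphState G‖ = 1 := by
  have h1 : ∀ x, ‖(graphState G).ofLp x‖ ^ 2 = (2 ^ Fintype.card V : ℝ)⁻¹ := by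
    intro x
    have hp : ‖∏ e ∈ G.edgeFinset, if ∀ v ∈ e, x v = 1 then (-1 : ℂ) else 1‖ = 1 := by
      rw [norm_prod]
      refine Finset.prod_eq_one fun e _ => ?_
      split_ifs <;> simp
    rw [graphState_apply, norm_mul, hp, one_mul, norm_pow, norm_inv, Complex.norm_real,
      Real.norm_of_nonneg (Real.sqrt_nonneg 2), ← pow_mul, mul_comm, pow_mul, inv_pow,
      Real.sq_sqrt (by norm_num), inv_pow]
  rw [EuclideanSpace.norm_eq, Real.sqrt_eq_one]
  simp [h1]

/-! ### The generalized toric graph -/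

/-- The vertices `(i, j, k) ∈ [L]³`; the coordinate `a : Fin L` stands for `a + 1 ∈ {1, …, L}`. -/
abbrev GToricVertex (L : ℕ) : Type := Fin L × Fin L × Fin L

/-- The Kronecker delta `δ_{a,b}`. -/
def kron (a b : ℕ) : ZMod 2 := if a = b then 1 else 0

/-- The Kronecker delta `δ_{a,b}` for coordinates modulo `L`. -/
def kronMod (L a b : ℕ) : ZMod 2 := if a ≡ b [MOD L] then 1 else 0

/-- The Heaviside function `θ_{a,b}`, equal to `1` iff `a ≤ b`. -/
def theta (a b : ℕ) : ZMod 2 := if a ≤ b then 1 else 0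

/-- The entries of the adjacency matrix in terms of coordinates in `{1, …, L}`. The coordinates
`j` and `k` are periodic with period `L`. -/
def gtoricEntry (L i₁ j₁ k₁ i₂ j₂ k₂ : ℕ) : ZMod 2 :=
  kronMod L j₁ j₂ * kronMod L k₁ k₂ * (kron i₁ 1 * theta 2 i₂ + kron i₂ 1 * theta 2 i₁) +
  kronMod L j₁ j₂ * (kronMod L k₁ (k₂ + 1) * theta i₂ i₁ * theta 2 i₂ +
    kronMod L k₂ (k₁ + 1) * theta i₁ i₂ * theta 2 i₁) +
  kronMod L j₁ (j₂ + 1) * kronMod L k₁ (k₂ + 1) * theta i₂ i₁ * theta 2 i₂ +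
  kronMod L j₂ (j₁ + 1) * kronMod L k₂ (k₁ + 1) * theta i₁ i₂ * theta 2 i₁

/-- The adjacency matrix, over `ℤ/2`, of the generalized toric graph. -/
def gtoricMatrix (L : ℕ) : Matrix (GToricVertex L) (GToricVertex L) (ZMod 2) :=
  Matrix.of fun u v => gtoricEntry L (u.1 + 1) (u.2.1 + 1) (u.2.2 + 1)
    (v.1 + 1) (v.2.1 + 1) (v.2.2 + 1)

theorem gtoricMatrix_symm (L : ℕ) (u v : GToricVertex L) :
    gtoricMatrix L u v = gtoricMatrix L v u := by
  have hc : ∀ a b, kronMod L a b = kronMod L b a := by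
    intro a b; unfold kronMod; simp only [Nat.ModEq.comm]
  simp only [gtoricMatrix, Matrix.of_apply, gtoricEntry]
  rw [hc (u.2.1 + 1) (v.2.1 + 1), hc (u.2.2 + 1) (v.2.2 + 1)]
  ring

theorem gtoricMatrix_diag (L : ℕ) (u : GToricVertex L) : gtoricMatrix L u u = 0 := by
  have h2 : ∀ a : ZMod 2, a + a = 0 := by decide
  simp only [gtoricMatrix, Matrix.of_apply, gtoricEntry, h2, mul_zero, zero_add]

/-- The generalized toric graph on the vertex set `[L]³`. -/
def gtoricGraph (L : ℕ) : SimpleGraph (GToricVertex L) where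
  Adj u v := gtoricMatrix L u v = 1
  symm := ⟨fun u v h => by rw [← gtoricMatrix_symm]; exact h⟩
  loopless := ⟨fun u h => by rw [gtoricMatrix_diag] at h; exact zero_ne_one h⟩

instance gtoricGraph_decidable (L : ℕ) : DecidableRel (gtoricGraph L).Adj :=
  fun u v => inferInstanceAs (Decidable (gtoricMatrix L u v = 1))

/-- The family of generalized toric graph states on `L³` qubits, `L = 1, 2, 3, …`. -/
def gtoricFamily : StateFamily where
  ι := ℕ+
  Qubit L := GToricVertex L
  fintypeQubit _ := inferInstance
  decEqQubit _ := inferInstance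
  infinite_index := inferInstance
  card_injective := by
    intro L M h
    have h' : (L : ℕ) ^ 3 = (M : ℕ) ^ 3 := by
      simp only [Fintype.card_prod, Fintype.card_fin] at h
      rw [pow_three, pow_three]; exact h
    exact PNat.coe_injective (Nat.pow_left_injective (by norm_num) h')
  state L := graphState (gtoricGraph L)
  norm_state _ := norm_graphState _

end

/-! Let u be the indicator of the bottom line {(0, j, 0)}, and take the code spanned by |G⟩ and Z^u
|G⟩. The states Z^s |G⟩ are orthonormal, and X^k Z^l sends Z^t |G⟩ to ±Z^(t + l + Ak) |G⟩, with A
the adjacency matrix over ℤ/2 (`inner_flippedGraphState_pauliOp`). So a Pauli can escape detection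
only if l + Ak = u (a logical flip), or if l + Ak = 0 and u · k ≠ 0 (opposite signs on the two basis
states).

A flip has weight at least L: a bottom vertex has neighbours only in its own column, so the support
meets each of the L columns over the line (`le_pauliWeight_of_add_eq_line`). A Pauli of the second
kind has weight at least L - 1: A maps each line at height i ≠ 0 to the bottom line
(`adjMatrix_mulVec_gtoricLine`), so l has odd overlap with L - 1 disjoint lines
(`le_pauliWeight_of_add_eq_zero`). Since Z^u is a flip of weight L, the distance is L - 1 or L,
which is Θ(n^(1/3)) for n = L³. -/

noncomputable section

open scoped Fin.CommRing

/-! ### Characters of (ℤ/2)^V -/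

section GraphStates

/-- The nontrivial additive character `a ↦ (-1) ^ a` of `ℤ/2`. -/
def signChar : AddChar (Fin 2) ℂ where
  toFun a := if a = 0 then 1 else -1
  map_zero_eq_one' := by simp
  map_add_eq_mul' := by
    intro a b
    fin_cases a <;> fin_cases b <;> simp [show (1 : Fin 2) + 1 = 0 from rfl]

theorem signChar_one : signChar 1 = -1 := by
  simp [signChar]

theorem conj_signChar (a : Fin 2) : (starRingEnd ℂ) (signChar a) = signChar a := by
  fin_cases a <;> simp [signChar]

theorem signChar_sum {ι : Type*} (s : Finset ι) (f : ι → Fin 2) :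
    signChar (∑ i ∈ s, f i) = ∏ i ∈ s, signChar (f i) := by
  classical
  induction s using Finset.induction_on with
  | empty => simp
  | insert a s ha ih => rw [Finset.sum_insert ha, Finset.prod_insert ha, AddChar.map_add_eq_mul, ih]

variable {V : Type} [Fintype V] [DecidableEq V]

theorem sum_signChar_dotProduct (w : V → Fin 2) :
    ∑ x : V → Fin 2, signChar (w ⬝ᵥ x) = if w = 0 then (2 : ℂ) ^ Fintype.card V else 0 := by
  have h : ∀ b : Fin 2, ∑ a : Fin 2, signChar (b * a) = if b = 0 then (2 : ℂ) else 0 := by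
    intro b
    fin_cases b <;> norm_num [Fin.sum_univ_two, signChar_one]
  simp_rw [dotProduct, signChar_sum]
  rw [← Fintype.piFinset_univ, Finset.sum_prod_piFinset Finset.univ
    (fun v a => signChar (w v * a))]
  simp_rw [h]
  split_ifs with hw
  · simp [hw]
  · obtain ⟨v, hv⟩ := Function.ne_iff.1 hw
    exact Finset.prod_eq_zero (Finset.mem_univ v) (if_neg hv)

/-! ### The quadratic form of a graph -/

/-- The product of the values of `x` at the end points of an edge. -/
def edgeMul (x : V → Fin 2) : Sym2 V → Fin 2 :=
  Sym2.lift ⟨fun u v => x u * x v, fun _ _ => mul_comm _ _⟩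

/-- The quadratic form `x ↦ ∑_{uv ∈ E} x_u x_v` of a graph. -/
def graphQuad (G : SimpleGraph V) [DecidableRel G.Adj] (x : V → Fin 2) : Fin 2 :=
  ∑ e ∈ G.edgeFinset, edgeMul x e

omit [DecidableEq V] in
theorem graphQuad_zero (G : SimpleGraph V) [DecidableRel G.Adj] : graphQuad G 0 = 0 := by
  refine Finset.sum_eq_zero fun e _ => ?_
  induction e using Sym2.ind with
  | _ u v => simp [edgeMul]

theorem signChar_edgeMul (x : V → Fin 2) (e : Sym2 V) :
    signChar (edgeMul x e) = if ∀ v ∈ e, x v = 1 then -1 else 1 := by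
  induction e using Sym2.ind with
  | _ u v =>
    have : ∀ a b : Fin 2, signChar (a * b) = if a = 1 ∧ b = 1 then -1 else 1 := by
      intro a b
      fin_cases a <;> fin_cases b <;> simp [signChar]
    simp [edgeMul, this]

theorem graphState_apply_eq_signChar (G : SimpleGraph V) [DecidableRel G.Adj] (x : V → Fin 2) :
    (graphState G).ofLp x =
      signChar (graphQuad G x) * (((Real.sqrt 2 : ℝ) : ℂ)⁻¹) ^ Fintype.card V := by
  simp_rw [graphState_apply, graphQuad, signChar_sum, signChar_edgeMul]

-- Each edge carries exactly two darts, and darts are the ordered adjacent pairs.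
omit [DecidableEq V] in
theorem sum_edgeFinset_lift_add (G : SimpleGraph V) [DecidableRel G.Adj] (F : V → V → Fin 2) :
    ∑ e ∈ G.edgeFinset, Sym2.lift ⟨fun u v => F u v + F v u, fun _ _ => add_comm _ _⟩ e =
      ∑ u, ∑ v, if G.Adj u v then F u v else 0 := by
  classical
  have h1 : ∑ d : G.Dart, F d.fst d.snd = ∑ u, ∑ v, if G.Adj u v then F u v else 0 := by
    rw [← Finset.sum_product', Finset.univ_product_univ, ← Finset.sum_filter]
    refine Finset.sum_bij (fun d _ => d.toProd) (fun d _ => by simp [d.adj])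
      (fun d _ d' _ h => SimpleGraph.Dart.ext _ _ h) (fun p hp => ?_) (fun _ _ => rfl)
    exact ⟨⟨p, by simpa using hp⟩, Finset.mem_univ _, rfl⟩
  rw [← h1, ← Finset.sum_fiberwise_of_maps_to (s := Finset.univ) (t := G.edgeFinset)
    (g := SimpleGraph.Dart.edge) (fun d _ => by simp)]
  refine Finset.sum_congr rfl fun e he => ?_
  induction e using Sym2.ind with
  | _ u v =>
    have hd : G.Adj u v := by simpa using he
    have hf := SimpleGraph.Dart.edge_fiber (⟨(u, v), hd⟩ : G.Dart)
    rw [SimpleGraph.Dart.edge_mk] at hf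
    rw [hf, Finset.sum_pair (SimpleGraph.Dart.symm_ne _).symm]
    rfl

-- The polar form of the edge quadratic form is the adjacency form; this is how A enters the action
-- of X^k.
omit [DecidableEq V] in
theorem graphQuad_add (G : SimpleGraph V) [DecidableRel G.Adj] (x y : V → Fin 2) :
    graphQuad G (x + y) =
      graphQuad G x + graphQuad G y + x ⬝ᵥ (G.adjMatrix (Fin 2) *ᵥ y) := by
  have h : x ⬝ᵥ (G.adjMatrix (Fin 2) *ᵥ y) = ∑ u, ∑ v, if G.Adj u v then x u * y v else 0 := by
    simp [dotProduct, Matrix.mulVec, Finset.mul_sum]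
  rw [h, ← sum_edgeFinset_lift_add, graphQuad, graphQuad, graphQuad, ← Finset.sum_add_distrib,
    ← Finset.sum_add_distrib]
  refine Finset.sum_congr rfl fun e _ => ?_
  induction e using Sym2.ind with
  | _ u v =>
    simp only [edgeMul, Sym2.lift_mk, Pi.add_apply]
    ring

/-! ### Graph states with phase flips -/

/-- The state `Z^s |G⟩`. -/
def flippedGraphState (G : SimpleGraph V) [DecidableRel G.Adj] (s : V → Fin 2) : QubitSpace V :=
  WithLp.toLp 2 fun x => signChar (s ⬝ᵥ x) * (graphState G).ofLp x

theorem flippedGraphState_zero (G : SimpleGraph V) [DecidableRel G.Adj] :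
    flippedGraphState G 0 = graphState G := by
  ext x
  simp [flippedGraphState]

omit [DecidableEq V] in
theorem pauliOp_apply (k l x y : V → Fin 2) :
    pauliOp k l x y = if y = x + k then signChar (l ⬝ᵥ y) else 0 := by
  have h : ∀ a b c d : Fin 2, (pauliX ^ (a : ℕ) * pauliZ ^ (b : ℕ)) c d =
      if d = c + a then signChar (b * d) else 0 := by
    intro a b c d
    fin_cases a <;> fin_cases b <;> fin_cases c <;> fin_cases d <;>
      simp [pauliX, pauliZ, signChar, Matrix.mul_apply]
  simp only [pauliOp, tensorOp, Matrix.of_apply, h, dotProduct, signChar_sum]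
  split_ifs with hy
  · subst hy
    simp
  · obtain ⟨v, hv⟩ := Function.ne_iff.1 hy
    exact Finset.prod_eq_zero (Finset.mem_univ v) (if_neg hv)

theorem pauliOp_app_apply (k l : V → Fin 2) (ψ : QubitSpace V) (x : V → Fin 2) :
    ((pauliOp k l).app ψ).ofLp x = signChar (l ⬝ᵥ (x + k)) * ψ.ofLp (x + k) := by
  simp [QubitOp.app, Matrix.mulVec, dotProduct, pauliOp_apply]

/-- All amplitudes are equal up to sign. In the product of the two amplitudes at x the quadratic
exponents cancel, leaving one linear in x, so the overlap is a character sum. -/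
theorem inner_flippedGraphState_pauliOp (G : SimpleGraph V) [DecidableRel G.Adj]
    (s t k l : V → Fin 2) :
    inner ℂ (flippedGraphState G s) ((pauliOp k l).app (flippedGraphState G t)) =
      if s + t + l + G.adjMatrix (Fin 2) *ᵥ k = 0 then signChar (graphQuad G k + (l + t) ⬝ᵥ k)
      else 0 := by
  have h2 : (2 : Fin 2) = 0 := rfl
  set c : ℂ := (((Real.sqrt 2 : ℝ) : ℂ)⁻¹) ^ Fintype.card V with hc
  have hcc : (starRingEnd ℂ) c = c := by simp [hc, Complex.conj_ofReal]
  have hc2 : c * c * 2 ^ Fintype.card V = 1 := by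
    have : ((Real.sqrt 2 : ℝ) : ℂ) * ((Real.sqrt 2 : ℝ) : ℂ) = 2 := by
      rw [← Complex.ofReal_mul, Real.mul_self_sqrt (by norm_num)]
      norm_num
    rw [hc, ← mul_pow, ← mul_pow, ← mul_inv, this]
    simp
  have key : ∀ x : V → Fin 2,
      inner ℂ ((flippedGraphState G s).ofLp x)
        (((pauliOp k l).app (flippedGraphState G t)).ofLp x) =
      signChar (graphQuad G k + (l + t) ⬝ᵥ k) * (c * c) *
        signChar ((s + t + l + G.adjMatrix (Fin 2) *ᵥ k) ⬝ᵥ x) := by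
    intro x
    have e : l ⬝ᵥ (x + k) + (t ⬝ᵥ (x + k) + graphQuad G (x + k)) + (s ⬝ᵥ x + graphQuad G x) =
        graphQuad G k + (l + t) ⬝ᵥ k + (s + t + l + G.adjMatrix (Fin 2) *ᵥ k) ⬝ᵥ x := by
      rw [graphQuad_add, dotProduct_comm x]
      simp only [dotProduct_add, add_dotProduct]
      linear_combination graphQuad G x * h2
    have e' := congrArg signChar e
    simp only [AddChar.map_add_eq_mul] at e'
    rw [pauliOp_app_apply]
    simp only [flippedGraphState, graphState_apply_eq_signChar, ← hc, RCLike.inner_apply, map_mul,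
      conj_signChar, hcc, AddChar.map_add_eq_mul]
    linear_combination c * c * e'
  rw [PiLp.inner_apply, Finset.sum_congr rfl fun x _ => key x, ← Finset.mul_sum,
    sum_signChar_dotProduct]
  split_ifs
  · rw [mul_assoc, hc2, mul_one]
  · rw [mul_zero]

theorem inner_flippedGraphState (G : SimpleGraph V) [DecidableRel G.Adj] (s t : V → Fin 2) :
    inner ℂ (flippedGraphState G s) (flippedGraphState G t) = if s = t then (1 : ℂ) else 0 := by
  have h := inner_flippedGraphState_pauliOp G s t 0 0
  have h1 : (pauliOp 0 0).app (flippedGraphState G t) = flippedGraphState G t := by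
    ext x
    simp [pauliOp_app_apply]
  have h2 : s + t = 0 ↔ s = t := by
    rw [funext_iff, funext_iff]
    refine forall_congr' fun v => ?_
    have : ∀ a b : Fin 2, a + b = 0 ↔ a = b := by decide
    exact this _ _
  rw [h1] at h
  simpa [h2, graphQuad_zero] using h

/-! ### The code spanned by `|G⟩` and `Z^u |G⟩` -/

/-- Both sides are sesquilinear, so one common α on a spanning set suffices. -/
theorem isDetectable_span {S : Set (QubitSpace V)} {O : QubitOp V} {α : ℂ}
    (h : ∀ φ ∈ S, ∀ ψ ∈ S, inner ℂ φ (O.app ψ) = α * inner ℂ φ ψ) :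
    IsDetectable (Submodule.span ℂ S) O := by
  have hadd : ∀ ψ₁ ψ₂ : QubitSpace V, O.app (ψ₁ + ψ₂) = O.app ψ₁ + O.app ψ₂ := by
    intro ψ₁ ψ₂
    ext x
    simp [QubitOp.app, Matrix.mulVec_add]
  have hsmul : ∀ (a : ℂ) (ψ : QubitSpace V), O.app (a • ψ) = a • O.app ψ := by
    intro a ψ
    ext x
    simp [QubitOp.app, Matrix.mulVec_smul]
  have hzero : O.app 0 = 0 := by simpa using hsmul 0 0
  refine ⟨α, fun φ hφ ψ hψ => ?_⟩
  induction hφ, hψ using Submodule.span_induction₂ with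
  | mem_mem φ ψ hφ hψ => exact h φ hφ ψ hψ
  | zero_left ψ _ => simp
  | zero_right φ _ => simp [hzero]
  | add_left φ₁ φ₂ ψ _ _ _ h₁ h₂ => simp only [inner_add_left, h₁, h₂, mul_add]
  | add_right φ ψ₁ ψ₂ _ _ _ h₁ h₂ => simp only [hadd, inner_add_right, h₁, h₂, mul_add]
  | smul_left a φ ψ _ _ h => simp only [inner_smul_left, h]; ring
  | smul_right a φ ψ _ _ h => simp only [hsmul, inner_smul_right, h]; ring

variable (G : SimpleGraph V) [DecidableRel G.Adj] (u : V → Fin 2)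

/-- The code spanned by `|G⟩` and `Z^u |G⟩`. -/
def flipCode : Submodule ℂ (QubitSpace V) :=
  Submodule.span ℂ (Set.range fun t : Fin 2 => flippedGraphState G (t • u))

theorem flippedGraphState_mem_flipCode (t : Fin 2) :
    flippedGraphState G (t • u) ∈ flipCode G u :=
  Submodule.subset_span ⟨t, rfl⟩

theorem graphState_mem_flipCode : graphState G ∈ flipCode G u := by
  simpa [flippedGraphState_zero] using flippedGraphState_mem_flipCode G u 0

theorem finrank_flipCode {u : V → Fin 2} (hu : u ≠ 0) :
    Module.finrank ℂ (flipCode G u) = 2 := by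
  obtain ⟨v, hv⟩ := Function.ne_iff.1 hu
  have hinj : ∀ s t : Fin 2, s • u = t • u ↔ s = t := by
    refine fun s t => ⟨fun h => ?_, fun h => h ▸ rfl⟩
    have key : ∀ a s t : Fin 2, a ≠ 0 → s * a = t * a → s = t := by decide
    exact key (u v) s t hv (congrFun h v)
  have ho : Orthonormal ℂ fun t : Fin 2 => flippedGraphState G (t • u) := by
    rw [orthonormal_iff_ite]
    intro s t
    rw [inner_flippedGraphState]
    simp only [hinj]
  rw [flipCode, finrank_span_eq_card ho.linearIndependent, Fintype.card_fin]

theorem isDetectable_flipCode {k l : V → Fin 2}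
    (h₁ : l + G.adjMatrix (Fin 2) *ᵥ k ≠ u)
    (h₀ : l + G.adjMatrix (Fin 2) *ᵥ k = 0 → u ⬝ᵥ k = 0) :
    IsDetectable (flipCode G u) (pauliOp k l) := by
  -- If l + Ak = 0 the Pauli is diagonal on the basis, with the same sign on both states because u ·
  -- k = 0. Otherwise l + Ak is neither 0 nor u, and all matrix elements vanish.
  refine isDetectable_span (α := if l + G.adjMatrix (Fin 2) *ᵥ k = 0 then
    signChar (graphQuad G k + l ⬝ᵥ k) else 0) ?_
  rintro _ ⟨s, rfl⟩ _ ⟨t, rfl⟩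
  have hch : ∀ a b : Fin 2, a + b = 0 ↔ a = b := by decide
  simp only [inner_flippedGraphState_pauliOp, inner_flippedGraphState, add_assoc]
  rw [← add_assoc, ← add_smul]
  by_cases h : l + G.adjMatrix (Fin 2) *ᵥ k = 0
  · have h2 : (s + t) • u = 0 ↔ s • u = t • u := by
      simp only [funext_iff, add_smul, Pi.add_apply, Pi.zero_apply, hch]
    simp only [h, add_zero, h2, if_true, add_dotProduct, smul_dotProduct, h₀ h, smul_zero]
    split_ifs <;> simp
  · have h3 : ¬ (s + t) • u + (l + G.adjMatrix (Fin 2) *ᵥ k) = 0 := by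
      intro hz
      have h01 : ∀ a : Fin 2, a = 0 ∨ a = 1 := by decide
      rcases h01 (s + t) with h0 | h0
      · rw [h0, zero_smul, zero_add] at hz
        exact h hz
      · rw [h0, one_smul] at hz
        refine h₁ (funext fun v => ((hch _ _).1 (congrFun hz v)).symm)
    simp [h, h3]

theorem not_isDetectable_flipCode {u : V → Fin 2} (hu : u ≠ 0) :
    ¬ IsDetectable (flipCode G u) (pauliOp 0 u) := by
  rintro ⟨α, h⟩
  have huu : u + u = 0 := by
    have : ∀ a : Fin 2, a + a = 0 := by decide
    exact funext fun v => this _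
  have m0 := flippedGraphState_mem_flipCode G u 0
  have m1 := flippedGraphState_mem_flipCode G u 1
  have e1 := h _ m0 _ m1
  simp [inner_flippedGraphState_pauliOp, inner_flippedGraphState, hu.symm, huu,
    graphQuad_zero] at e1

/-- The one-logical-qubit code spanned by `|G⟩` and `Z^u |G⟩` has a distance `d`
between `m` and the weight of `u`, if the Paulis that it does not detect have weight at least `m`. -/
theorem exists_isQECC_flipCode {u : V → Fin 2} (hu : u ≠ 0) {m : ℕ}
    (h₁ : ∀ k l : V → Fin 2, l + G.adjMatrix (Fin 2) *ᵥ k = u → m ≤ pauliWeight k l)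
    (h₀ : ∀ k l : V → Fin 2, l + G.adjMatrix (Fin 2) *ᵥ k = 0 → u ⬝ᵥ k ≠ 0 →
      m ≤ pauliWeight k l) :
    ∃ d, m ≤ d ∧ d ≤ pauliWeight 0 u ∧ IsQECC (flipCode G u) 1 d := by
  classical
  have hex : ∃ d, ∃ k l : V → Fin 2, pauliWeight k l = d ∧
      ¬ IsDetectable (flipCode G u) (pauliOp k l) :=
    ⟨_, 0, u, rfl, not_isDetectable_flipCode G hu⟩
  obtain ⟨v, -⟩ := Function.ne_iff.1 hu
  -- The distance is the least weight of an undetected Pauli, so its exact value need not be known.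
  refine ⟨Nat.find hex, ?_, Nat.find_le ⟨0, u, rfl, not_isDetectable_flipCode G hu⟩, le_rfl,
    Fintype.card_pos_iff.2 ⟨v⟩, by rw [finrank_flipCode G hu, pow_one], fun k l hkl => ?_,
    Nat.find_spec hex⟩
  · obtain ⟨k, l, hw, hd⟩ := Nat.find_spec hex
    rw [← hw]
    by_contra hlt
    exact hd (isDetectable_flipCode G u (fun h => hlt (h₁ k l h))
      fun h => by_contra fun h' => hlt (h₀ k l h h'))
  · by_contra hd
    exact Nat.find_min hex hkl ⟨k, l, rfl, hd⟩

end GraphStates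

/-! ### Lines in the generalized toric graph -/

theorem sum_kronMod_add (L : ℕ) [NeZero L] (a c : ℕ) :
    ∑ j : Fin L, kronMod L a (j + c) = 1 := by
  have h : ∀ j : Fin L, kronMod L a (j + c) =
      if j = ⟨((a : ZMod L) - c).val, ZMod.val_lt _⟩ then 1 else 0 := by
    intro j
    unfold kronMod
    refine if_congr ?_ rfl rfl
    rw [← ZMod.natCast_eq_natCast_iff, Nat.cast_add, ← sub_eq_iff_eq_add]
    refine ⟨fun h => Fin.ext ?_, fun h => ?_⟩
    · exact (ZMod.val_natCast_of_lt j.isLt).symm.trans (congrArg ZMod.val h.symm)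
    · rw [h, ZMod.natCast_zmod_val]
  simp [h]

theorem kronMod_comm (L a b : ℕ) : kronMod L a b = kronMod L b a := by
  unfold kronMod
  simp only [Nat.ModEq.comm]

theorem kronMod_succ_succ {L : ℕ} (a b : Fin L) :
    kronMod L (a + 1) (b + 1) = if a = b then 1 else 0 := by
  unfold kronMod
  refine if_congr ?_ rfl rfl
  rw [Fin.ext_iff]
  exact ⟨fun h => (Nat.ModEq.add_right_cancel' 1 h).eq_of_lt_of_lt a.isLt b.isLt,
    fun h => h ▸ rfl⟩

variable {L : ℕ} [NeZero L]

theorem sum_gtoricMatrix_line {i : Fin L} (hi : i ≠ 0) (k : Fin L) (v : GToricVertex L) :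
    ∑ j : Fin L, gtoricMatrix L v (i, j, k) = if v.1 = 0 ∧ v.2.2 = k then 1 else 0 := by
  obtain ⟨i₁, j₁, k₁⟩ := v
  have hi' : (i : ℕ) ≠ 0 := fun h => hi (Fin.ext h)
  have h1 : kron (i + 1) 1 = 0 := if_neg (by omega)
  have h2 : theta 2 (i + 1) = 1 := if_pos (by omega)
  have h3 : kron (i₁ + 1) 1 = if i₁ = 0 then 1 else 0 :=
    if_congr (by rw [Fin.ext_iff, Fin.val_zero]; omega) rfl rfl
  have s1 := sum_kronMod_add L (j₁ + 1) 1
  have s2 := sum_kronMod_add L (j₁ + 1) (1 + 1)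
  have s3 := sum_kronMod_add L (j₁ + 1 + 1) 1
  simp_rw [← add_assoc] at s2
  simp_rw [kronMod_comm L (j₁ + 1 + 1)] at s3
  simp only [gtoricMatrix, Matrix.of_apply, gtoricEntry, Finset.sum_add_distrib, mul_assoc,
    ← Finset.sum_mul, s1, s2, s3, h1, h2, h3, kronMod_succ_succ k₁ k]
  -- Summing over j removes the j-shift, so the last two terms of the adjacency matrix cancel the
  -- second one mod 2.
  have h4 : ∀ a b c : ZMod 2, a + (b + c) + b + c = a := by decide
  simp only [one_mul, mul_one, zero_mul, add_zero, h4, ← ite_and, mul_ite, mul_zero]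

/-- At height 1 (index 0) every shifted term dies: θ_{2,1} = 0, and no i satisfies 2 ≤ i ≤ 1. Only
the column term is left. -/
theorem gtoricMatrix_bottom_eq_zero {j k : Fin L} {w : GToricVertex L}
    (h : w.2 = (j, k) → w.1 = 0) : gtoricMatrix L (0, j, k) w = 0 := by
  obtain ⟨i, j', k'⟩ := w
  have h1 : theta 2 (0 + 1) = 0 := rfl
  have h2 : theta (i + 1) (0 + 1) * theta 2 (i + 1) = 0 := by
    unfold theta
    split_ifs <;> first | omega | simp
  simp only [gtoricMatrix, Matrix.of_apply, gtoricEntry, Fin.val_zero, h1, mul_zero, mul_assoc, h2,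
    add_zero, kronMod_succ_succ]
  by_cases hj : j = j'
  · by_cases hk : k = k'
    · have hi : i = 0 := h (by rw [hj, hk])
      simp [hi, h1]
    · simp [hk]
  · simp [hj]

omit [NeZero L] in
theorem gtoricGraph_adjMatrix_apply (v w : GToricVertex L) :
    (gtoricGraph L).adjMatrix (Fin 2) v w = gtoricMatrix L v w := by
  -- `ZMod 2` unfolds to `Fin 2`, so entries of the two types are compared directly.
  have h : ∀ a : ZMod 2, (1 : Fin 2) = a ∧ a = 1 ∨ (0 : Fin 2) = a ∧ a ≠ 1 := by
    intro a
    fin_cases a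
    · exact Or.inr ⟨rfl, zero_ne_one⟩
    · exact Or.inl ⟨rfl, rfl⟩
  rw [SimpleGraph.adjMatrix_apply]
  rcases h (gtoricMatrix L v w) with ⟨h0, h1⟩ | ⟨h0, h1⟩
  · rw [if_pos (show (gtoricGraph L).Adj v w from h1)]
    exact h0
  · rw [if_neg (show ¬ (gtoricGraph L).Adj v w from h1)]
    exact h0

/-- The indicator function of the line `{(i, j, k) : j}`. -/
def gtoricLine (i k : Fin L) (v : GToricVertex L) : Fin 2 :=
  if v.1 = i ∧ v.2.2 = k then 1 else 0

omit [NeZero L] in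
theorem dotProduct_gtoricLine (x : GToricVertex L → Fin 2) (i k : Fin L) :
    x ⬝ᵥ gtoricLine i k = ∑ j, x (i, j, k) := by
  simp [dotProduct, gtoricLine, Fintype.sum_prod_type, ite_and]

theorem adjMatrix_mulVec_gtoricLine {i : Fin L} (hi : i ≠ 0) (k : Fin L) :
    (gtoricGraph L).adjMatrix (Fin 2) *ᵥ gtoricLine i k = gtoricLine 0 k := by
  funext v
  have h := dotProduct_gtoricLine ((gtoricGraph L).adjMatrix (Fin 2) v) i k
  simp only [gtoricGraph_adjMatrix_apply] at h
  exact h.trans (sum_gtoricMatrix_line hi k v)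

theorem adjMatrix_mulVec_bottom {a : GToricVertex L → Fin 2} {j k : Fin L}
    (ha : ∀ i, a (i, j, k) = 0) :
    ((gtoricGraph L).adjMatrix (Fin 2) *ᵥ a) (0, j, k) = 0 := by
  refine Finset.sum_eq_zero fun w _ => ?_
  by_cases hw : w.2 = (j, k)
  · rw [show w = (w.1, j, k) from Prod.ext rfl hw, ha, mul_zero]
  · have h0 : (gtoricGraph L).adjMatrix (Fin 2) (0, j, k) w = 0 :=
      (gtoricGraph_adjMatrix_apply _ _).trans (gtoricMatrix_bottom_eq_zero fun h => absurd h hw)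
    exact mul_eq_zero_of_left h0 _

/-! ### Weight bounds and the code distance -/

theorem le_pauliWeight_of_add_eq_line {a b : GToricVertex L → Fin 2} {k : Fin L}
    (h : b + (gtoricGraph L).adjMatrix (Fin 2) *ᵥ a = gtoricLine 0 k) :
    L ≤ pauliWeight a b := by
  have hex : ∀ j : Fin L, ∃ i : Fin L, a (i, j, k) ≠ 0 ∨ b (i, j, k) ≠ 0 := by
    intro j
    -- If a and b vanish on the whole column over (j, k), the left side of `h` is 0 at (0, j, k),
    -- where the line has value 1.
    by_contra! hj
    have := congrFun h (0, j, k)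
    rw [Pi.add_apply, (hj 0).2, adjMatrix_mulVec_bottom fun i => (hj i).1] at this
    simp [gtoricLine] at this
  choose f hf using hex
  calc L = (Finset.univ : Finset (Fin L)).card := by simp
    _ ≤ _ := Finset.card_le_card_of_injOn (fun j => (f j, j, k)) (fun j _ => by simpa using hf j)
      fun j _ j' _ hj => congrArg (fun v : GToricVertex L => v.2.1) hj

theorem le_pauliWeight_of_add_eq_zero {a b : GToricVertex L → Fin 2} {k : Fin L}
    (h : b + (gtoricGraph L).adjMatrix (Fin 2) *ᵥ a = 0) (ha : gtoricLine 0 k ⬝ᵥ a ≠ 0) :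
    L - 1 ≤ pauliWeight a b := by
  have hex : ∀ i : Fin L, ∃ j : Fin L, i ≠ 0 → b (i, j, k) ≠ 0 := by
    intro i
    by_contra! hi
    have hb : b ⬝ᵥ gtoricLine i k = 0 := by
      rw [dotProduct_gtoricLine]
      exact Finset.sum_eq_zero fun j _ => (hi j).2
    -- Pair the equation with the line at height i and move the symmetric A onto that line: what
    -- remains is the overlap of a with the bottom line.
    have h0 := congrArg (· ⬝ᵥ gtoricLine i k) h
    simp only [add_dotProduct, hb, zero_add, zero_dotProduct] at h0
    rw [dotProduct_comm, Matrix.dotProduct_mulVec, ← Matrix.mulVec_transpose,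
      SimpleGraph.transpose_adjMatrix, adjMatrix_mulVec_gtoricLine (hi 0).1] at h0
    exact ha h0
  choose f hf using hex
  calc L - 1 = ((Finset.univ : Finset (Fin L)).erase 0).card := by simp
    _ ≤ _ := Finset.card_le_card_of_injOn (fun i => (i, f i, k))
      (fun i hi => by simpa using Or.inr (hf i (Finset.ne_of_mem_erase hi)))
      fun i _ i' _ hi => congrArg Prod.fst hi

omit [NeZero L] in
theorem pauliWeight_gtoricLine_le (i k : Fin L) :
    pauliWeight 0 (gtoricLine i k) ≤ L := by
  calc pauliWeight 0 (gtoricLine i k)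
      ≤ ((Finset.univ : Finset (Fin L)).image fun j => ((i, j, k) : GToricVertex L)).card := by
        refine Finset.card_le_card fun v hv => ?_
        obtain ⟨i', j', k'⟩ := v
        have : i' = i ∧ k' = k := by simpa [gtoricLine] using hv
        simp [this]
    _ ≤ L := Finset.card_image_le.trans (by simp)

theorem exists_isQECC_gtoricGraph (L : ℕ) [NeZero L] :
    ∃ d, L - 1 ≤ d ∧ d ≤ L ∧ IsQECC (flipCode (gtoricGraph L) (gtoricLine 0 0)) 1 d := by
  have hu : gtoricLine (0 : Fin L) 0 ≠ 0 := fun h => by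
    simpa [gtoricLine] using congrFun h (0, 0, 0)
  obtain ⟨d, h1, h2, h3⟩ := exists_isQECC_flipCode (gtoricGraph L) hu (m := L - 1)
    (fun a b h => (Nat.sub_le _ _).trans (le_pauliWeight_of_add_eq_line h))
    fun a b h ha => le_pauliWeight_of_add_eq_zero h ha
  exact ⟨d, h1, h2.trans (pauliWeight_gtoricLine_le 0 0), h3⟩

theorem card_gtoricVertex (L : ℕ) : Fintype.card (GToricVertex L) = L ^ 3 := by
  simp only [Fintype.card_prod, Fintype.card_fin]
  ring

end

/-! ### Asymptotics of the distance -/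

theorem mainTheorem8 : gtoricFamily ∈ TQO1 := by
  choose d hd1 hd2 hd using fun L : ℕ+ => exists_isQECC_gtoricGraph (L : ℕ)
  have hmem := fun L : ℕ+ => graphState_mem_flipCode (gtoricGraph L) (gtoricLine 0 0)
  refine ⟨_, fun _ => 1, d, hd, ⟨1 / 3, by norm_num, by norm_num, ?_⟩, hmem⟩
  have hsize : ∀ L : ℕ+, gtoricFamily.size L = (L : ℕ) ^ 3 :=
    fun L => card_gtoricVertex L
  have hpow : ∀ L : ℕ+, (gtoricFamily.size L : ℝ) ^ (1 / 3 : ℝ) = (L : ℕ) := by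
    intro L
    rw [hsize, Nat.cast_pow, ← Real.rpow_natCast, ← Real.rpow_mul (Nat.cast_nonneg _)]
    norm_num
  have hle : ∀ L : ℕ+, ‖(d L : ℝ)‖ ≤ ‖(gtoricFamily.size L : ℝ) ^ (1 / 3 : ℝ)‖ := by
    intro L
    rw [hpow, Real.norm_natCast, Real.norm_natCast]
    exact_mod_cast hd2 L
  -- For L = 1 the bound L - 1 ≤ d is empty; from L = 2 on, L ≤ 2(L - 1) ≤ 2d.
  have hge : ∀ L : ℕ+, 2 ≤ gtoricFamily.size L →
      ‖(gtoricFamily.size L : ℝ) ^ (1 / 3 : ℝ)‖ ≤ 2 * ‖(d L : ℝ)‖ := by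
    intro L hL
    have h2 : (L : ℕ) ≠ 1 := by
      intro h
      rw [hsize, h] at hL
      omega
    have h0 := L.pos
    have h := hd1 L
    rw [hpow, Real.norm_natCast, Real.norm_natCast]
    exact_mod_cast (by omega : (L : ℕ) ≤ 2 * d L)
  exact ⟨.of_bound' (.of_forall hle), .of_bound 2 (Filter.mem_of_superset
    (Filter.preimage_mem_comap (Filter.Ici_mem_atTop 2)) hge)⟩
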